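/- **Connecting Lemma.** A $k$-graph $\mathcal H$ on a finite vertex set $V$ has as edges a family of $k$-element subsets of $V$. Write $n=|V|$; $\deg(S)$ is the number of edges containing $S\subseteq V$, and $\delta_d(\mathcal H)$ is the minimum of $\deg(S)$ over all $d$-element sets $S\subseteq V$. For a partition $V=A\cup B$ with $|A|=\lfloor n/2\rfloor$, $|B|=\lceil n/2\rceil$, let $\mathcal B_{n,k}(A,B)$ (respectively $\overline{\mathcal B}_{n,k}(A,B)$) be the $k$-graph on $V$ whose edges are all $k$-sets meeting $A$ in an odd (respectively even) number of vertices. We say that $\mathcal H$ is $\epsilon$-close to $\mathcal B_{n,k}$ (to $\overline{\mathcal B}_{n,k}$) if for some such partition $\mathcal H$ can be turned into a copy of $\mathcal B_{n,k}(A,B)$ (of $\overline{\mathcal B}_{n,k}(A,B)$) by adding and deleting at most $\epsilon n^k$ edges. For even $k$, a $(k/2)$-path of length $t\ge 1$ in $\mathcal H$ is a sequence of distinct vertices $v_1,\dots,v_p$ with $p=(t-1)k/2+k$ such that $\{v_{ik/2+1},\dots,v_{ik/2+k}\}$ is an edge for every $0\le i<t$; its ends are the set of its first $k/2$ vertices and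 the set of its last $k/2$ vertices. For disjoint $(k/2)$-sets $S,T\subseteq V$, a connecting $m$-set for $S$ and $T$ is an $m$-element set $C\subseteq V\setminus(S\cup T)$ such that $\mathcal H$ has a $(k/2)$-path with ends $S$ and $T$ whose vertex set is $S\cup C\cup T$. Then there are increasing functions $f,g,h:(0,\infty)\to(0,\infty)$ such that the following holds for all integers $k,d,n$ with $k\ge 4$ even, $k/2\le d\le k-1$, $n\ge 1$, and all real $\epsilon,\gamma>0$ with $\epsilon\le f(1/k)$, $\gamma\le g(\epsilon)$, $1/n\le h(\gamma)$ (that is, whenever $1/n\ll\gamma\ll\epsilon\ll 1/k$). If $\mathcal H$ is a $k$-graph on $n$ vertices with $$\delta_d(\mathcal H)\ge\Big(\frac12-\gamma\Big)\binom{n-d}{k-d}$$ and $\mathcal H$ is neither $\epsilon$-close to $\mathcal B_{n,k}$ nor $\epsilon$-close to $\overline{\mathcal B}_{n,k}$, then any two disjoint $(k/2)$-sets $S,T\subseteq V$ have at least $\gamma^4n^{3k/2}$ connecting $(3k/2)$-sets. -/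

import Mathlib

/-- A `k`-graph (`k`-uniform hypergraph) on the vertex set `V`. -/
structure KGraph (V : Type*) (k : ℕ) where
  /-- the edges -/
  edges : Finset (Finset V)
  card_of_mem : ∀ e ∈ edges, e.card = k

namespace KGraph

variable {V : Type*} [DecidableEq V] {k : ℕ}

/-- `deg_H(S)`: the number of edges containing `S`. -/
def degree (H : KGraph V k) (S : Finset V) : ℕ :=
  (H.edges.filter fun e => S ⊆ e).card

/-- The minimum `d`-degree `δ_d(H)`: the minimum of `deg_H(S)` over all `d`-sets `S` of vertices. -/
noncomputable def minDegree (H : KGraph V k) (d : ℕ) : ℕ :=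
  ⨅ S : {S : Finset V // S.card = d}, H.degree S.1

/-- The copy of `H` obtained by relabelling its vertices along the permutation `σ`. -/
def relabel (H : KGraph V k) (σ : Equiv.Perm V) : KGraph V k where
  edges := H.edges.image fun e => e.map σ.toEmbedding
  card_of_mem := by
    intro e he
    obtain ⟨e', he', rfl⟩ := Finset.mem_image.1 he
    rw [Finset.card_map]
    exact H.card_of_mem e' he'

/-- `H` is `ε`-close to `H'`: adding and deleting at most `ε n ^ k` edges turns `H` into a copy
of `H'`, where `n` is the number of vertices. -/
def IsClose [Fintype V] (ε : ℝ) (H H' : KGraph V k) : Prop :=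
  ∃ σ : Equiv.Perm V,
    ((symmDiff H.edges (H'.relabel σ).edges).card : ℝ) ≤ ε * (Fintype.card V : ℝ) ^ k

/-- `𝓑_{n,k}(A, B)` with `B = V ∖ A`: the edges are the `k`-sets meeting `A` in an odd number of
vertices. -/
def oddGraph [Fintype V] (k : ℕ) (A : Finset V) : KGraph V k where
  edges := (Finset.univ.powersetCard k).filter fun e => Odd (e ∩ A).card
  card_of_mem := fun _ he => (Finset.mem_powersetCard.1 (Finset.mem_filter.1 he).1).2

/-- `𝓑̅_{n,k}(A, B)` with `B = V ∖ A`: the edges are the `k`-sets meeting `A` in an even number of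
vertices. -/
def evenGraph [Fintype V] (k : ℕ) (A : Finset V) : KGraph V k where
  edges := (Finset.univ.powersetCard k).filter fun e => Even (e ∩ A).card
  card_of_mem := fun _ he => (Finset.mem_powersetCard.1 (Finset.mem_filter.1 he).1).2

/-- `H` is `ε`-close to `𝓑_{n,k}`, that is, to `𝓑_{n,k}(A, B)` for an equipartition `V = A ∪ B`
(`|A| = ⌊n/2⌋` and `|B| = ⌈n/2⌉`). -/
def IsCloseToOdd [Fintype V] (ε : ℝ) (H : KGraph V k) : Prop :=
  ∃ A : Finset V, A.card = Fintype.card V / 2 ∧ H.IsClose ε (oddGraph k A)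

/-- `H` is `ε`-close to `𝓑̅_{n,k}`, that is, to `𝓑̅_{n,k}(A, B)` for an equipartition `V = A ∪ B`
(`|A| = ⌊n/2⌋` and `|B| = ⌈n/2⌉`). -/
def IsCloseToEven [Fintype V] (ε : ℝ) (H : KGraph V k) : Prop :=
  ∃ A : Finset V, A.card = Fintype.card V / 2 ∧ H.IsClose ε (evenGraph k A)

/-- The sequence `P` of distinct vertices is a `k`-uniform `ℓ`-path of length `t` in `H`: it has
`(t - 1) (k - ℓ) + k` vertices, and for each `i < t` the `k` consecutive vertices that follow the
first `i (k - ℓ)` ones form an edge of `H`. -/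
def IsPath (H : KGraph V k) (ℓ t : ℕ) (P : List V) : Prop :=
  1 ≤ t ∧ P.Nodup ∧ P.length = (t - 1) * (k - ℓ) + k ∧
    ∀ i < t, ((P.drop (i * (k - ℓ))).take k).toFinset ∈ H.edges

/-- `C` is a connecting set for the `(k/2)`-sets `A` and `B`: it is disjoint from `A` and `B`, and
`H[A ∪ C ∪ B]` contains a `(k/2)`-path with ends `A` (its first `k/2` vertices) and `B` (its last
`k/2` vertices) that uses all the vertices of `A ∪ C ∪ B`. -/
def IsConnecting (H : KGraph V k) (A B C : Finset V) : Prop :=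
  Disjoint C A ∧ Disjoint C B ∧
    ∃ (t : ℕ) (P : List V), H.IsPath (k / 2) t P ∧ P.toFinset = A ∪ C ∪ B ∧
      (P.take (k / 2)).toFinset = A ∧ (P.drop (P.length - k / 2)).toFinset = B

/-- The family of the connecting `m`-sets for `A` and `B`. -/
noncomputable def connectingSets [Fintype V] (H : KGraph V k) (m : ℕ) (A B : Finset V) :
    Finset (Finset V) := by
  classical
  exact (Finset.univ.powersetCard m).filter fun C => H.IsConnecting A B C

end KGraph

/-! Put `r = k/2` and view `H` as a dense graph on the `r`-tuples of vertices, `X` and `Y` being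
adjacent when their entries together form an edge. A connecting `3r`-set is, up to ordering, a
nondegenerate walk `s, x, y, z, t` of length four. Averaging the degree condition down to `r`-tuples
(`le_density_mark_half`) makes every neighbourhood have density at least `1/2 - γ`.

Suppose there are fewer than `γ ^ 4 n ^ (3r)` connecting sets. Then the walks have density at most
`γ ^ 3` (`density_walk_le`), so almost every `y` has almost no common neighbours with `s` or with
`t`. Two almost disjoint neighbourhoods of density about `1/2` are almost complementary, hence every
typical row of the adjacency sign matrix is plus or minus the row `p` of `s`. By symmetry of the
matrix it is nearly `σ p(X) p(Y)`, and `p` is nearly balanced (`exists_sign_of_few_walks`).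

The sign of a `2r`-tuple does not depend on the order of its entries. Exchanging entries between the
two halves one at a time forces `p(X)` to be nearly `c ∏ a(X i)` for signs `a` on `V`
(`exists_prod_of_symmetric`). Balance of `p` makes the mean of `a` small (`abs_expect_pow_le`), so
`a` is nearly the sign function of an equipartition (`exists_half_card_density_le`). Thus edges are
determined, up to few errors, by the parity of their intersection with one half, which is the
excluded closeness (`isClose_of_sign`). -/

open Finset BigOperators

/-! ### Densities of events for uniformly random points and tuples -/

section Density

open Classical in
/-- The proportion of the elements of a finite type that satisfy a predicate. -/
noncomputable def density {α : Type*} [Fintype α] (s : α → Prop) : ℝ :=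
  𝔼 x, if s x then (1 : ℝ) else 0

variable {α β γ : Type*} [Fintype α] [Fintype β] [Fintype γ]

theorem density_eq_card_div (s : α → Prop) [DecidablePred s] :
    density s = (#{x | s x} : ℝ) / Fintype.card α := by
  classical
  simp only [density, Fintype.expect_eq_sum_div_card]
  rw [← sum_boole]
  congr!

theorem density_nonneg (s : α → Prop) : 0 ≤ density s :=
  expect_nonneg fun x _ => by split_ifs <;> norm_num

theorem density_mono {s t : α → Prop} (h : ∀ x, s x → t x) : density s ≤ density t := by
  classical
  refine expect_le_expect fun x _ => ?_
  have := h x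
  split_ifs <;> simp_all

theorem density_congr {s t : α → Prop} (h : ∀ x, s x ↔ t x) : density s = density t :=
  le_antisymm (density_mono fun x => (h x).1) (density_mono fun x => (h x).2)

theorem density_or_add_density_and (s t : α → Prop) :
    density (fun x => s x ∨ t x) + density (fun x => s x ∧ t x) = density s + density t := by
  classical
  simp only [density, ← expect_add_distrib]
  refine expect_congr rfl fun x _ => ?_
  by_cases h1 : s x <;> by_cases h2 : t x <;> simp [h1, h2]

theorem density_or_le (s t : α → Prop) : density (fun x => s x ∨ t x) ≤ density s + density t := by
  linarith [density_or_add_density_and s t, density_nonneg fun x => s x ∧ t x]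

theorem density_le_add {s t u : α → Prop} (h : ∀ x, s x → t x ∨ u x) :
    density s ≤ density t + density u :=
  (density_mono h).trans (density_or_le t u)

theorem density_exists_le {ι : Type*} [Fintype ι] (s : ι → α → Prop) :
    density (fun x => ∃ i, s i x) ≤ ∑ i, density (s i) := by
  classical
  simp only [density]
  rw [← expect_sum_comm]
  refine expect_le_expect fun x _ => ?_
  split_ifs with h
  · obtain ⟨i, hi⟩ := h
    refine le_trans ?_ (single_le_sum (fun j _ => ?_) (mem_univ i))
    · simp [hi]
    · split_ifs <;> norm_num
  · exact sum_nonneg fun j _ => by split_ifs <;> norm_num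

theorem density_not_add [Nonempty α] (s : α → Prop) : density (fun x => ¬ s x) + density s = 1 := by
  classical
  simp only [density, ← expect_add_distrib]
  rw [← Fintype.expect_one (ι := α) (M := ℝ)]
  refine expect_congr rfl fun x _ => ?_
  by_cases h1 : s x <;> simp [h1]

theorem density_equiv (e : α ≃ β) (s : β → Prop) : density (fun x => s (e x)) = density s := by
  classical
  exact Fintype.expect_equiv e _ _ fun x => rfl

theorem density_prod (s : α × β → Prop) : density s = 𝔼 a, density fun b => s (a, b) := by
  classical
  simp only [density]
  rw [← univ_product_univ, expect_product]

theorem density_prod_swap (s : α × β → Prop) : density s = 𝔼 b, density fun a => s (a, b) := by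
  rw [← density_equiv (Equiv.prodComm β α), density_prod]
  rfl

theorem density_prod_le [Nonempty α] {s : α × β → Prop} {c : ℝ}
    (h : ∀ a, density (fun b => s (a, b)) ≤ c) : density s ≤ c := by
  rw [density_prod]
  exact expect_le univ_nonempty fun a _ => h a

theorem le_density_prod [Nonempty α] {s : α × β → Prop} {c : ℝ}
    (h : ∀ a, c ≤ density (fun b => s (a, b))) : c ≤ density s := by
  rw [density_prod]
  exact le_expect univ_nonempty fun a _ => h a

theorem exists_density_le [Nonempty β] {s : α × β → Prop} {c : ℝ} (h : density s ≤ c) :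
    ∃ b, density (fun a => s (a, b)) ≤ c := by
  rw [density_prod_swap] at h
  obtain ⟨b, -, hb⟩ := exists_le_of_expect_le univ_nonempty h
  exact ⟨b, hb⟩

theorem density_fst [Nonempty β] (s : α → Prop) : density (fun x : α × β => s x.1) = density s := by
  rw [density_prod_swap]
  exact Fintype.expect_const (ι := β) (density s)

/-- The product of two independent predicates. -/
theorem density_and_prod (s : α → Prop) (t : β → Prop) :
    density (fun x : α × β => s x.1 ∧ t x.2) = density s * density t := by
  classical
  rw [density_prod]
  simp only [density]
  rw [expect_mul]
  refine expect_congr rfl fun a _ => ?_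
  by_cases h : s a <;> simp [h]

/-- Restricting a uniformly random tuple to some of its coordinates gives a uniformly random
tuple. -/
theorem density_comp_injective {I J V : Type*} [Fintype I] [Fintype J] [DecidableEq I]
    [DecidableEq J] [Fintype V] [Nonempty V] {φ : I → J} (hφ : Function.Injective φ)
    (s : (I → V) → Prop) : density (fun v : J → V => s (v ∘ φ)) = density s := by
  classical
  let e : I ⊕ ↥(Set.range φ)ᶜ ≃ J :=
    ((Equiv.ofInjective φ hφ).sumCongr (Equiv.refl _)).trans (Equiv.Set.sumCompl _)
  let E : (J → V) ≃ (I → V) × (↥(Set.range φ)ᶜ → V) :=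
    (Equiv.arrowCongr e.symm (Equiv.refl V)).trans (Equiv.sumArrowEquivProdArrow _ _ _)
  have h1 : ∀ v, (E v).1 = v ∘ φ := by
    intro v
    funext i
    simp [E, e, Equiv.sumArrowEquivProdArrow]
  rw [← density_fst (β := ↥(Set.range φ)ᶜ → V) s, ← density_equiv E]
  simp only [h1]

theorem density_eq_apply {V : Type*} [Fintype V] (c : V) :
    density (fun x => x = c) = 1 / Fintype.card V := by
  classical
  rw [density_eq_card_div, filter_eq' univ c]
  simp

theorem density_apply {J V : Type*} [Fintype J] [DecidableEq J] [Fintype V] [Nonempty V] (j : J)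
    (s : V → Prop) : density (fun v : J → V => s (v j)) = density s := by
  have := density_comp_injective (J := J) (V := V) (φ := fun _ : Unit => j)
    (fun _ _ _ => rfl) (fun v => s (v ()))
  simp only [Function.comp] at this
  rw [this]
  exact density_equiv (Equiv.funUnique Unit V) s

theorem density_apply_eq_apply {J V : Type*} [Fintype J] [DecidableEq J] [Fintype V] [Nonempty V]
    {i j : J} (hij : i ≠ j) : density (fun v : J → V => v i = v j) = 1 / Fintype.card V := by
  have hφ : Function.Injective (Sum.elim (fun _ : Unit => i) fun _ : Unit => j) := by
    rintro (a | a) (b | b) <;> simp [hij, hij.symm]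
  have := density_comp_injective (V := V) hφ (fun v => v (Sum.inl ()) = v (Sum.inr ()))
  simp only [Function.comp, Sum.elim_inl, Sum.elim_inr] at this
  rw [this, ← density_equiv (Equiv.sumArrowEquivProdArrow Unit Unit V).symm, density_prod_swap]
  refine (expect_congr rfl fun b _ => ?_).trans (Fintype.expect_const (ι := Unit → V) _)
  simp only [Equiv.sumArrowEquivProdArrow, Equiv.coe_fn_symm_mk, Sum.elim_inl, Sum.elim_inr]
  rw [density_apply () (fun x => x = b ()), density_eq_apply]

/-- A random tuple that is not injective or meets a fixed set is unlikely. -/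
theorem density_not_injective_or_mem_le {J V : Type*} [Fintype J] [DecidableEq J] [Fintype V]
    [Nonempty V] (F : Finset V) :
    density (fun v : J → V => ¬ (Function.Injective v ∧ ∀ j, v j ∉ F)) ≤
      (Fintype.card J * (Fintype.card J + #F) : ℝ) / Fintype.card V := by
  classical
  have h1 : density (fun v : J → V => ∃ p : J × J, p.1 ≠ p.2 ∧ v p.1 = v p.2) ≤
      (Fintype.card J * Fintype.card J : ℝ) / Fintype.card V := by
    refine (density_exists_le _).trans ?_
    refine (sum_le_card_nsmul _ _ (1 / Fintype.card V : ℝ) fun p _ => ?_).trans ?_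
    · by_cases hp : p.1 = p.2
      · rw [density_congr (t := fun _ => False) (by simp [hp])]
        simp [density]
      · exact (density_mono fun v hv => hv.2).trans (density_apply_eq_apply hp).le
    · simp [div_eq_mul_inv]
  have h2 : density (fun v : J → V => ∃ p : J × F, v p.1 = p.2) ≤
      (Fintype.card J * #F : ℝ) / Fintype.card V := by
    refine (density_exists_le _).trans ?_
    refine (sum_le_card_nsmul _ _ (1 / Fintype.card V : ℝ) fun p _ => ?_).trans ?_
    · rw [density_apply p.1 (fun x => x = (p.2 : V)), density_eq_apply]
    · simp [div_eq_mul_inv]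
  refine (density_le_add fun v hv => ?_).trans ((add_le_add h1 h2).trans (by rw [← add_div, mul_add]))
  by_contra! hc
  refine hv ⟨fun i j hij => ?_, fun j hj => hc.2 (j, ⟨v j, hj⟩) rfl⟩
  by_contra h
  exact hc.1 (i, j) h hij

end Density

/-! ### Dense graphs with few walks of length four between two vertices -/

section AlmostBipartite

theorem Int.units_mul_swap : ∀ a b c d : ℤˣ, a * b = c * d → a * d = c * b := by
  decide

variable {U : Type*} [Fintype U] [Nonempty U]

/-- Fubini with an exceptional set of first coordinates, which is charged in full. -/
theorem density_le_prod_split {α β : Type*} [Fintype α] [Fintype β] [Nonempty α] [Nonempty β]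
    {s : α × β → Prop} {b : α → Prop} {c d : ℝ} (hb : density b ≤ c)
    (h : ∀ a, ¬ b a → density (fun y => s (a, y)) ≤ d) (hd : 0 ≤ d) : density s ≤ c + d := by
  refine (density_le_add (t := fun x => b x.1) (u := fun x => s x ∧ ¬ b x.1) fun x hx => ?_).trans
    (add_le_add ((density_fst b).trans_le hb) (density_prod_le fun a => ?_))
  · tauto
  · by_cases ha : b a
    · simpa [ha, density] using hd
    · simpa [ha] using h a ha

/-- Two sets of density about `1/2` with little overlap are nearly complementary: by
inclusion-exclusion at most `2γ + c` lies outside both, and the overlap adds another `c`. -/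
theorem density_eq_le_of_common_le {p q : U → ℤˣ} {γ : ℝ}
    (hp : 1 / 2 - γ ≤ density fun y => p y = 1) (hq : 1 / 2 - γ ≤ density fun y => q y = 1)
    {c : ℝ} (hpq : density (fun y => p y = 1 ∧ q y = 1) ≤ c) :
    density (fun y => p y = q y) ≤ 2 * γ + 2 * c := by
  have h1 := density_or_add_density_and (fun y => p y = 1) (fun y => q y = 1)
  have h2 := density_not_add (fun y => p y = 1 ∨ q y = 1)
  have h3 : density (fun y => p y = q y) ≤ _ := density_le_add
    (t := fun y => p y = 1 ∧ q y = 1) (u := fun y => ¬ (p y = 1 ∨ q y = 1)) fun y hy => by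
      rw [hy]
      tauto
  linarith

/-- The structure of graphs with minimum degree close to half the number of vertices in which some
two vertices are joined by few walks of length four. A graph is described here by a symmetric
function that is `1` on its edges and `-1` on its non-edges. -/
theorem exists_sign_of_few_walks (m : U → U → ℤˣ) (hm : ∀ x y, m x y = m y x) {γ : ℝ}
    (hγ : 0 < γ) (hγ' : γ ≤ 1 / 4) (hdeg : ∀ x, 1 / 2 - γ ≤ density fun y => m x y = 1) (s t : U)
    (hwalk : density (fun v : U × U × U => (m s v.2.1 = 1 ∧ m v.1 v.2.1 = 1) ∧
      (m t v.2.2 = 1 ∧ m v.1 v.2.2 = 1)) ≤ γ ^ 3) :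
    (∃ σ : ℤˣ, density (fun v : U × U => m v.1 v.2 ≠ σ * (m s v.1 * m s v.2)) ≤ 69 * γ) ∧
      |density (fun y => m s y = 1) - 1 / 2| ≤ 9 * γ := by
  classical
  set P : U → Prop := fun x => density (fun y => m s y = 1 ∧ m x y = 1) ≤ γ with hP
  set Q : U → Prop := fun x => density (fun y => m t y = 1 ∧ m x y = 1) ≤ γ with hQ
  -- Once the middle vertex is fixed, the two halves of the walk are independent, so its
  -- contribution is a product of two codegrees. Both exceed `γ` at a bad vertex, and Markov's
  -- inequality applies.
  have hbad : density (fun x => ¬ (P x ∨ Q x)) ≤ γ := by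
    have h1 : γ ^ 2 * density (fun x => ¬ (P x ∨ Q x)) ≤ γ ^ 3 := by
      refine le_trans ?_ hwalk
      rw [density_prod, density, mul_expect]
      refine expect_le_expect fun y _ => ?_
      rw [density_and_prod (fun x => m s x = 1 ∧ m y x = 1) (fun x => m t x = 1 ∧ m y x = 1)]
      by_cases h : P y ∨ Q y
      · rw [if_neg (not_not.2 h), mul_zero]
        exact mul_nonneg (density_nonneg _) (density_nonneg _)
      · rw [if_pos h, mul_one]
        simp only [hP, hQ, not_or, not_le] at h
        nlinarith [h.1, h.2]
    have h2 : 0 < γ ^ 2 := by positivity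
    nlinarith
  -- Count the edges into the common neighbourhood `A` of `s` and `t` twice: a vertex with `P` or
  -- `Q` sends at most `γ` into `A`, whereas each vertex of `A` has degree at least `1/2 - γ ≥ 1/4`.
  have hst : density (fun y => m s y = 1 ∧ m t y = 1) ≤ 8 * γ := by
    set A : U → Prop := fun y => m s y = 1 ∧ m t y = 1 with hA
    have h1 : density (fun v : U × U => m v.1 v.2 = 1 ∧ A v.2) ≤ γ + γ := by
      refine density_le_prod_split hbad (fun x hx => ?_) hγ.le
      rw [not_not] at hx
      rcases hx with hx | hx
      · exact (density_mono fun y hy => ⟨hy.2.1, hy.1⟩).trans hx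
      · exact (density_mono fun y hy => ⟨hy.2.2, hy.1⟩).trans hx
    have h2 : (1 / 2 - γ) * density A ≤ density (fun v : U × U => m v.1 v.2 = 1 ∧ A v.2) := by
      rw [density_prod_swap, density, mul_expect]
      refine expect_le_expect fun y _ => ?_
      split_ifs with h
      · simpa [h, hm _ y] using hdeg y
      · simpa using density_nonneg _
    nlinarith [density_nonneg A]
  have hopp := density_eq_le_of_common_le (hdeg s) (hdeg t) hst
  have hrow : ∀ {a x}, density (fun y => m a y = 1 ∧ m x y = 1) ≤ γ →
      density (fun y => m a y = m x y) ≤ 4 * γ := fun {a x} h =>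
    (density_eq_le_of_common_le (hdeg a) (hdeg x) h).trans (by linarith)
  -- Under `P` the row of `x` is nearly opposite to that of `s`. Under `Q` it is nearly opposite to
  -- that of `t`, which is itself nearly opposite to that of `s`, so the rows of `x` and `s` nearly
  -- agree.
  set u : U → ℤˣ := fun x => if P x then -1 else 1 with hu
  have hmu : density (fun v : U × U => m v.1 v.2 ≠ u v.1 * m s v.2) ≤ γ + 22 * γ := by
    refine density_le_prod_split hbad (fun x hx => ?_) (by positivity)
    rw [not_not] at hx
    by_cases hPx : P x
    · simp only [hu, hPx, if_true]
      refine (density_mono fun y hy => ?_).trans ((hrow hPx).trans (by linarith))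
      rcases Int.units_eq_one_or (m x y) with h | h <;>
        rcases Int.units_eq_one_or (m s y) with h' | h' <;> simp_all
    · have hQx : Q x := by tauto
      simp only [hu, hPx, if_false]
      refine (density_le_add (t := fun y => m s y = m t y) (u := fun y => m t y = m x y)
        fun y hy => ?_).trans ((add_le_add hopp (hrow hQx)).trans (by linarith))
      rcases Int.units_eq_one_or (m x y) with h | h <;>
        rcases Int.units_eq_one_or (m s y) with h' | h' <;>
          rcases Int.units_eq_one_or (m t y) with h'' | h'' <;> simp_all
  have hmu' : density (fun v : U × U => m v.2 v.1 ≠ u v.2 * m s v.1) ≤ 23 * γ := by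
    have := density_equiv (Equiv.prodComm U U) fun v : U × U => m v.1 v.2 ≠ u v.1 * m s v.2
    exact this.trans_le (by linarith)
  -- Symmetry of `m` gives `u x * m s y = u y * m s x` for most pairs, so `u x * m s x` is nearly
  -- constant. Its value at a typical `y` serves as `σ`.
  have hw : density (fun v : U × U => u v.1 * m s v.1 ≠ u v.2 * m s v.2) ≤ 46 * γ := by
    refine (density_le_add fun v hv => ?_).trans ((add_le_add hmu hmu').trans (by linarith))
    rw [hm v.2 v.1]
    by_contra! h
    exact hv (Int.units_mul_swap _ _ _ _ (h.1.symm.trans h.2))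
  obtain ⟨y, hy⟩ := exists_density_le hw
  refine ⟨⟨u y * m s y, ?_⟩, ?_⟩
  · have hy' := (density_fst (β := U) _).trans_le hy
    refine (density_le_add fun v hv => ?_).trans ((add_le_add hmu hy').trans (by linarith))
    by_contra! h
    apply hv
    rw [h.1, ← h.2]
    rcases Int.units_eq_one_or (m s v.1) with h1 | h1 <;> simp [h1]
  · have h1 : density (fun y => m s y = 1) ≤ _ := density_le_add
      (t := fun y => m s y = 1 ∧ m t y = 1) (u := fun y => ¬ m t y = 1) fun y hy => by tauto
    have h2 := density_not_add (fun y => m t y = 1)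
    rw [abs_le]
    constructor <;> linarith [hdeg s, hdeg t]

end AlmostBipartite

/-! ### From symmetry under permutations to a product over single entries -/

section ProductStructure

variable {V : Type*}

/-- The tuple that agrees with `z` on the first `i` coordinates and with `x` on the others. -/
def hybridTuple {r : ℕ} (i : ℕ) (x z : Fin r → V) : Fin r → V :=
  fun j => if (j : ℕ) < i then z j else x j

theorem hybridTuple_zero {r : ℕ} (x z : Fin r → V) : hybridTuple 0 x z = x := by
  funext j
  simp [hybridTuple]

theorem hybridTuple_self {r : ℕ} (x z : Fin r → V) : hybridTuple r x z = z := by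
  funext j
  simp [hybridTuple]

/-- Telescoping along the hybrids, which turn `x` into `z` one coordinate at a time. -/
theorem apply_eq_mul_prod_of_hybrid {r : ℕ} (p : (Fin r → V) → ℤˣ) (x z : Fin r → V)
    (q : Fin r → ℤˣ)
    (h : ∀ i : Fin r, p (hybridTuple i x z) = p (hybridTuple (i + 1) x z) * q i) :
    p x = p z * ∏ i, q i := by
  have key : ∀ i : ℕ, i ≤ r →
      p x = p (hybridTuple i x z) * ∏ j ∈ univ.filter (fun j : Fin r => (j : ℕ) < i), q j := by
    intro i
    induction i with
    | zero => intro _; simp [hybridTuple_zero]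
    | succ i ih =>
      intro hi
      have hs : univ.filter (fun j : Fin r => (j : ℕ) < i + 1) =
          insert ⟨i, hi⟩ (univ.filter fun j : Fin r => (j : ℕ) < i) := by
        ext j
        simp [Fin.ext_iff]
        omega
      rw [ih (by omega), hs, prod_insert (by simp), h ⟨i, hi⟩, mul_assoc]
  have := key r le_rfl
  rw [hybridTuple_self, filter_true_of_mem fun j _ => j.2] at this
  exact this

/-- The coordinates used in the `i`-th exchange step. -/
def exchangeIndex {r : ℕ} (j₀ i : Fin r) : Fin r ⊕ Fin r → Fin r ⊕ (Fin r ⊕ Fin r)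
  | Sum.inl j => if j < i then Sum.inr (Sum.inl j) else Sum.inl j
  | Sum.inr j => if j = j₀ then Sum.inr (Sum.inl i) else Sum.inr (Sum.inr j)

/-- The `i`-th hybrid uses `z j` only for `j < i`, so `z i` is still free to replace entry `j₀` of
`w`. By injectivity the tested `2r`-tuple is uniformly random, and the hypothesis on random tuples
applies to it. -/
theorem exchangeIndex_injective {r : ℕ} (j₀ i : Fin r) :
    Function.Injective (exchangeIndex j₀ i) := by
  rintro (a | a) (b | b) h <;> simp only [exchangeIndex] at h <;> split_ifs at h <;>
    simp_all

/-- If a symmetric sign function of `2r`-tuples is almost everywhere the product of signs of its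
two halves, then the sign of an `r`-tuple is almost everywhere a product over its entries. -/
theorem exists_prod_of_symmetric {r : ℕ} (j₀ : Fin r) [Fintype V] [Nonempty V]
    (m : (Fin r ⊕ Fin r → V) → ℤˣ)
    (hm : ∀ (v : Fin r ⊕ Fin r → V) (π : Equiv.Perm (Fin r ⊕ Fin r)), m (v ∘ π) = m v)
    (p : (Fin r → V) → ℤˣ) (σ : ℤˣ) {δ : ℝ}
    (h : density (fun v : Fin r ⊕ Fin r → V =>
      m v ≠ σ * (p (v ∘ Sum.inl) * p (v ∘ Sum.inr))) ≤ δ) :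
    ∃ (c : ℤˣ) (a : V → ℤˣ), density (fun x : Fin r → V => p x ≠ c * ∏ i, a (x i)) ≤
      2 * r * δ := by
  classical
  set bad : (Fin r ⊕ Fin r → V) → Prop := fun v =>
    m v ≠ σ * (p (v ∘ Sum.inl) * p (v ∘ Sum.inr)) with hbad
  have hswap : ∀ π : Equiv.Perm (Fin r ⊕ Fin r),
      density (fun v => bad v ∨ bad (v ∘ π)) ≤ 2 * δ := fun π => by
    refine (density_or_le _ _).trans ?_
    rw [density_comp_injective π.injective bad]
    linarith
  -- There are `r` exchange steps, each testing a tuple before and after its swap, whence the factor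
  -- `2 * r`.
  have hall : density (fun v : Fin r ⊕ (Fin r ⊕ Fin r) → V => ∃ i : Fin r,
      bad (v ∘ exchangeIndex j₀ i) ∨
        bad ((v ∘ exchangeIndex j₀ i) ∘ Equiv.swap (Sum.inl i) (Sum.inr j₀))) ≤ 2 * r * δ := by
    refine (density_exists_le _).trans ?_
    refine (sum_le_card_nsmul _ _ (2 * δ) fun i _ => ?_).trans (by simp; linarith)
    exact (density_comp_injective (exchangeIndex_injective j₀ i) fun v =>
      bad v ∨ bad (v ∘ Equiv.swap (Sum.inl i) (Sum.inr j₀))).trans_le (hswap _)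
  rw [← density_equiv (Equiv.sumArrowEquivProdArrow _ _ V).symm] at hall
  obtain ⟨y, hy⟩ := exists_density_le hall
  set z := y ∘ Sum.inl
  set w := y ∘ Sum.inr
  -- Fix a typical pair `z`, `w`. Swapping `x i` with the entry `z i` placed at `j₀` in `w` leaves
  -- `m` unchanged, so the ratio of consecutive hybrids is a function of `x i` times a constant.
  refine ⟨p z * ∏ i, p (Function.update w j₀ (z i)), fun x => p (Function.update w j₀ x),
    (density_mono fun x hx => ?_).trans hy⟩
  by_contra! hc
  refine hx ?_
  rw [mul_assoc, ← prod_mul_distrib]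
  refine apply_eq_mul_prod_of_hybrid p x z _ fun i => ?_
  have hi := hc i
  simp only [hbad, not_not, hm] at hi
  have h1 : ((Equiv.sumArrowEquivProdArrow _ _ V).symm (x, y) ∘ exchangeIndex j₀ i) ∘ Sum.inl =
      hybridTuple i x z := by
    funext j
    by_cases hj : j < i <;>
      simp [exchangeIndex, hybridTuple, Equiv.sumArrowEquivProdArrow, hj, z]
  have h2 : ((Equiv.sumArrowEquivProdArrow _ _ V).symm (x, y) ∘ exchangeIndex j₀ i) ∘ Sum.inr =
      Function.update w j₀ (z i) := by
    funext j
    by_cases hj : j = j₀ <;>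
      simp [exchangeIndex, Equiv.sumArrowEquivProdArrow, hj, z, w]
  have h3 : (((Equiv.sumArrowEquivProdArrow _ _ V).symm (x, y) ∘ exchangeIndex j₀ i) ∘
      Equiv.swap (Sum.inl i) (Sum.inr j₀)) ∘ Sum.inl = hybridTuple (i + 1) x z := by
    funext j
    rcases lt_trichotomy j i with hj | rfl | hj
    · have hj' : (j : ℕ) < i + 1 := by omega
      have hne : (Sum.inl j : Fin r ⊕ Fin r) ≠ Sum.inl i := by simp [hj.ne]
      simp [exchangeIndex, hybridTuple, Equiv.sumArrowEquivProdArrow, hj, z, hj',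
        Equiv.swap_apply_of_ne_of_ne hne Sum.inl_ne_inr]
    · simp [exchangeIndex, hybridTuple, Equiv.sumArrowEquivProdArrow, z]
    · have hj' : ¬ (j : ℕ) < i + 1 := by omega
      have hne : (Sum.inl j : Fin r ⊕ Fin r) ≠ Sum.inl i := by simp [hj.ne']
      simp [exchangeIndex, hybridTuple, Equiv.sumArrowEquivProdArrow, hj.not_gt, hj',
        Equiv.swap_apply_of_ne_of_ne hne Sum.inl_ne_inr]
  have h4 : (((Equiv.sumArrowEquivProdArrow _ _ V).symm (x, y) ∘ exchangeIndex j₀ i) ∘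
      Equiv.swap (Sum.inl i) (Sum.inr j₀)) ∘ Sum.inr = Function.update w j₀ (x i) := by
    funext j
    by_cases hj : j = j₀
    · simp [exchangeIndex, Equiv.sumArrowEquivProdArrow, hj]
    · have hne : (Sum.inr j : Fin r ⊕ Fin r) ≠ Sum.inr j₀ := by simp [hj]
      simp [exchangeIndex, Equiv.sumArrowEquivProdArrow, hj, w,
        Equiv.swap_apply_of_ne_of_ne Sum.inr_ne_inl hne]
  rw [h1, h2, h3, h4] at hi
  have h5 := mul_left_cancel (hi.1.symm.trans hi.2)
  rw [mul_comm (p (Function.update w j₀ (z i))), ← mul_assoc, ← h5, mul_assoc,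
    Int.units_mul_self, mul_one]

end ProductStructure

/-! ### Balanced products and equipartitions -/

section Balance

variable {V : Type*} [Fintype V]

theorem expect_units_eq {α : Type*} [Fintype α] [Nonempty α] (p : α → ℤˣ) :
    𝔼 x, ((p x : ℤ) : ℝ) = 2 * density (fun x => p x = 1) - 1 := by
  classical
  rw [density, mul_expect, ← Fintype.expect_one (ι := α) (M := ℝ), ← expect_sub_distrib]
  refine expect_congr rfl fun x _ => ?_
  rcases Int.units_eq_one_or (p x) with h | h <;> simp [h]
  norm_num

/-- The entries of a random tuple are independent, so the mean of the product is the `r`-th power of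
the mean of `a`, up to sign. Each disagreement of signs costs `2`, and the mean of `p` is twice its
density of ones minus `1`. -/
theorem abs_expect_pow_le [Nonempty V] {r : ℕ} {p : (Fin r → V) → ℤˣ} {c : ℤˣ} {a : V → ℤˣ}
    {δ₁ δ₂ : ℝ} (h₁ : density (fun x : Fin r → V => p x ≠ c * ∏ i, a (x i)) ≤ δ₁)
    (h₂ : |density (fun x => p x = 1) - 1 / 2| ≤ δ₂) :
    |𝔼 x, ((a x : ℤ) : ℝ)| ^ r ≤ 2 * δ₁ + 2 * δ₂ := by
  classical
  have h3 : |𝔼 x, (((p x : ℤ) : ℝ) - ((c * ∏ i, a (x i) : ℤˣ) : ℤ))| ≤ 2 * δ₁ := by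
    refine (abs_expect_le _ _).trans (le_trans ?_ (mul_le_mul_of_nonneg_left h₁ zero_le_two))
    rw [density, mul_expect]
    refine expect_le_expect fun x _ => ?_
    generalize c * ∏ i, a (x i) = q
    rcases Int.units_eq_one_or (p x) with h | h <;> rcases Int.units_eq_one_or q with h' | h' <;>
      simp [h, h'] <;> norm_num
  have h4 : 𝔼 x : Fin r → V, (((c * ∏ i, a (x i) : ℤˣ) : ℤ) : ℝ) =
      ((c : ℤ) : ℝ) * (𝔼 x, ((a x : ℤ) : ℝ)) ^ r := by
    rw [expect_pow, Fintype.piFinset_univ, mul_expect]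
    refine expect_congr rfl fun x _ => ?_
    push_cast
    rfl
  rw [expect_sub_distrib, h4, expect_units_eq] at h3
  have hc : |((c : ℤ) : ℝ)| = 1 := by
    rcases Int.units_eq_one_or c with h | h <;> simp [h]
  rw [← abs_pow, ← one_mul |_ ^ r|, ← hc, ← abs_mul]
  generalize ((c : ℤ) : ℝ) * (𝔼 x, ((a x : ℤ) : ℝ)) ^ r = q at h3 ⊢
  rw [abs_le] at *
  constructor <;> linarith [h3.1, h3.2, h₂.1, h₂.2]

/-- A sign function is close to that of a set containing half of the points if its mean is
small. -/
theorem exists_half_card_density_le [Nonempty V] [DecidableEq V] (a : V → ℤˣ) :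
    ∃ A : Finset V, #A = Fintype.card V / 2 ∧
      density (fun x => a x ≠ if x ∈ A then -1 else 1) ≤
        |𝔼 x, ((a x : ℤ) : ℝ)| / 2 + 1 / Fintype.card V := by
  classical
  set n := Fintype.card V with hn
  have hn0 : (0 : ℝ) < n := by exact_mod_cast Fintype.card_pos
  set B : Finset V := {x | a x = -1} with hB
  have hmean : 𝔼 x, ((a x : ℤ) : ℝ) = 1 - 2 * #B / n := by
    have h1 := density_not_add (fun x => a x = 1)
    have h2 : density (fun x => ¬ a x = 1) = (#B : ℝ) / n := by
      rw [density_eq_card_div]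
      congr 3
      ext x
      rcases Int.units_eq_one_or (a x) with h | h <;> simp [hB, h]
    rw [expect_units_eq]
    rw [h2] at h1
    rw [mul_div_assoc]
    linarith
  have hdiff : ∀ A : Finset V, density (fun x => a x ≠ if x ∈ A then -1 else 1) =
      (#(symmDiff A B) : ℝ) / n := by
    intro A
    rw [density_eq_card_div]
    congr 3
    ext x
    rcases Int.units_eq_one_or (a x) with h | h <;> by_cases h' : x ∈ A <;>
      simp [hB, h, h', mem_symmDiff]
  have hfin : ∀ A : Finset V, |(#B : ℝ) - n / 2| + 1 ≥ #(symmDiff A B) →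
      density (fun x => a x ≠ if x ∈ A then -1 else 1) ≤
        |𝔼 x, ((a x : ℤ) : ℝ)| / 2 + 1 / n := by
    intro A hA
    rw [hdiff, hmean]
    have h3 : (1 : ℝ) - 2 * #B / n = (n / 2 - #B) * (2 / n) := by
      field_simp
    rw [h3, abs_mul, abs_of_pos (by positivity : (0 : ℝ) < 2 / n), abs_sub_comm,
      div_le_iff₀ hn0]
    generalize |(#B : ℝ) - n / 2| = q at hA
    have h4 : (q * (2 / n) / 2 + 1 / n) * n = q + 1 := by
      field_simp
    linarith
  have hhalf1 : ((n / 2 : ℕ) : ℝ) ≤ n / 2 := Nat.cast_div_le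
  have hhalf2 : (n : ℝ) / 2 ≤ ((n / 2 : ℕ) : ℝ) + 1 := by
    have : (n : ℝ) ≤ 2 * ((n / 2 : ℕ) : ℝ) + 2 := by
      norm_cast
      omega
    linarith
  -- Taking `A` nested with `B` makes the symmetric difference as small as possible; the extra `1`
  -- allowed in `hfin` absorbs the rounding of `n / 2`.
  rcases le_total #B (n / 2) with h | h
  · obtain ⟨A, hBA, hA⟩ := exists_superset_card_eq h (Nat.div_le_self n 2)
    refine ⟨A, hA, hfin A ?_⟩
    rw [symmDiff_of_ge (by exact hBA), cast_card_sdiff hBA, hA]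
    linarith [neg_abs_le ((#B : ℝ) - n / 2)]
  · obtain ⟨A, hAB, hA⟩ := exists_subset_card_eq h
    refine ⟨A, hA, hfin A ?_⟩
    rw [symmDiff_of_le (by exact hAB), cast_card_sdiff hAB, hA]
    linarith [le_abs_self ((#B : ℝ) - n / 2)]

end Balance

/-! ### Edge signs of tuples -/

namespace KGraph

section Mark

variable {V : Type*} [DecidableEq V] {k : ℕ} {ι κ : Type*} [Fintype ι] [Fintype κ]

open Classical in
/-- The sign of a tuple of vertices: it is `1` on the tuples with a repeated vertex and on those
whose entries form an edge, and `-1` on the others. -/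
noncomputable def mark (H : KGraph V k) (v : ι → V) : ℤˣ :=
  if Function.Injective v → univ.image v ∈ H.edges then 1 else -1

theorem mark_eq_one_iff (H : KGraph V k) (v : ι → V) :
    H.mark v = 1 ↔ (Function.Injective v → univ.image v ∈ H.edges) := by
  unfold mark
  split_ifs with h
  · exact iff_of_true rfl h
  · exact iff_of_false (by decide) h

theorem mark_comp_equiv (H : KGraph V k) (v : ι → V) (e : κ ≃ ι) : H.mark (v ∘ e) = H.mark v := by
  have : univ.image (v ∘ e) = univ.image v := by
    ext x
    simp only [mem_image, mem_univ, true_and, Function.comp]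
    exact e.exists_congr_left.trans (by simp)
  have hinj : Function.Injective (v ∘ e) ↔ Function.Injective v := e.injective_comp v
  simp only [mark, this, hinj]

end Mark

end KGraph

/-! ### Closeness to the parity hypergraphs -/

namespace KGraph

variable {V : Type*} [DecidableEq V] {k : ℕ}

@[simp] theorem relabel_one_edges (H : KGraph V k) : (H.relabel 1).edges = H.edges := by
  ext e
  simp only [relabel, mem_image]
  constructor
  · rintro ⟨e', he', rfl⟩
    convert he'
    ext x
    simp [← Equiv.Perm.inv_def]
  · intro he
    refine ⟨e, he, ?_⟩
    ext x
    simp [← Equiv.Perm.inv_def]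

theorem exists_tuple_of_card {ι : Type*} [Fintype ι] {e : Finset V} (he : #e = Fintype.card ι) :
    ∃ v : ι → V, Function.Injective v ∧ univ.image v = e := by
  have f : ι ≃ e := Fintype.equivOfCardEq (by simp [he])
  refine ⟨fun i => f i, Subtype.val_injective.comp f.injective, ?_⟩
  ext x
  simp only [mem_image, mem_univ, true_and]
  constructor
  · rintro ⟨i, rfl⟩
    exact (f i).2
  · intro hx
    exact ⟨f.symm ⟨x, hx⟩, by simp⟩

theorem prod_sign_eq {ι : Type*} [Fintype ι] {v : ι → V} (hv : Function.Injective v)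
    (A : Finset V) :
    ∏ i, (if v i ∈ A then (-1 : ℤˣ) else 1) = (-1) ^ #(univ.image v ∩ A) := by
  rw [← prod_image (s := univ) (g := v) (f := fun x => if x ∈ A then (-1 : ℤˣ) else 1)
    (fun _ _ _ _ h => hv h), prod_ite, prod_const, prod_const_one, mul_one, filter_mem_eq_inter]

variable [Fintype V]

/-- If the sign of almost every tuple is the product of the signs of its entries, up to a global
sign, then the hypergraph is close to one of the two extremal ones. -/
theorem isClose_of_density_le {ι : Type*} [Fintype ι] [DecidableEq ι] (hι : Fintype.card ι = k)
    [Nonempty V]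
    (H : KGraph V k) {A : Finset V} (hA : #A = Fintype.card V / 2) (σ : ℤˣ) {ε : ℝ}
    (h : density (fun v : ι → V => H.mark v ≠ σ * ∏ i, if v i ∈ A then -1 else 1) ≤ ε) :
    H.IsCloseToOdd ε ∨ H.IsCloseToEven ε := by
  classical
  have key : ∀ G : KGraph V k, (∀ v : ι → V, Function.Injective v →
      (univ.image v ∈ G.edges ↔ σ * ∏ i, (if v i ∈ A then -1 else 1) = 1)) → H.IsClose ε G := by
    intro G hG
    refine ⟨1, ?_⟩
    rw [relabel_one_edges]
    rw [density_eq_card_div, div_le_iff₀ (by exact_mod_cast Fintype.card_pos)] at h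
    simp only [Fintype.card_fun, hι] at h
    push_cast at h
    refine le_trans (Nat.cast_le.2 ?_) h
    -- Every edge on which the hypergraphs differ is the image of an injective tuple with the wrong
    -- sign; one ordering of each edge suffices.
    refine card_le_card_of_surjOn (fun v => univ.image v) fun e he => ?_
    have hek : #e = k := by
      rcases mem_symmDiff.1 he with h' | h'
      · exact H.card_of_mem e h'.1
      · exact G.card_of_mem e h'.1
    obtain ⟨v, hv, rfl⟩ := exists_tuple_of_card (ι := ι) (hek.trans hι.symm)
    refine ⟨v, ?_, rfl⟩
    simp only [coe_filter, mem_univ, true_and, Set.mem_ofPred_eq]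
    intro heq
    have h1 := H.mark_eq_one_iff v
    rw [heq, ← hG v hv] at h1
    simp only [hv, true_imp_iff] at h1
    rcases mem_symmDiff.1 he with h' | h' <;> tauto
  have hodd : ∀ v : ι → V, Function.Injective v → #(univ.image v) = k := fun v hv => by
    rw [card_image_of_injective _ hv, card_univ, hι]
  -- The product of the signs is `-1` to the power of the size of the intersection with `A`, so `σ =
  -- 1` gives the even hypergraph and `σ = -1` the odd one.
  rcases Int.units_eq_one_or σ with rfl | rfl
  · refine Or.inr ⟨A, hA, key _ fun v hv => ?_⟩
    rw [prod_sign_eq hv, one_mul, neg_one_pow_eq_one_iff_even (by decide)]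
    simp [evenGraph, mem_powersetCard, hodd v hv]
  · refine Or.inl ⟨A, hA, key _ fun v hv => ?_⟩
    rw [prod_sign_eq hv, neg_one_mul, neg_eq_iff_eq_neg, neg_one_pow_eq_neg_one_iff_odd (by decide)]
    simp [oddGraph, mem_powersetCard, hodd v hv]

/-- Passage from the structure of the graph on `r`-tuples to the structure of the hypergraph. -/
theorem isClose_of_sign {r : ℕ} (hr : 0 < r) (hk : k = 2 * r) [Nonempty V] (H : KGraph V k)
    (p : (Fin r → V) → ℤˣ) {σ : ℤˣ} {γ ε : ℝ} (hγ : 0 < γ) (hε : 0 < ε) (hε1 : ε ≤ 1)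
    (hn : 1 / (Fintype.card V : ℝ) ≤ γ)
    (hσ : density (fun v : (Fin r → V) × (Fin r → V) =>
      H.mark (Sum.elim v.1 v.2) ≠ σ * (p v.1 * p v.2)) ≤ 69 * γ)
    (hp : |density (fun x => p x = 1) - 1 / 2| ≤ 9 * γ)
    (hγε : 350 * r * γ ≤ (ε / (8 * r)) ^ r) :
    H.IsCloseToOdd ε ∨ H.IsCloseToEven ε := by
  classical
  have hr1 : (1 : ℝ) ≤ r := by exact_mod_cast hr
  have hσ' : density (fun v : Fin r ⊕ Fin r → V =>
      H.mark v ≠ σ * (p (v ∘ Sum.inl) * p (v ∘ Sum.inr))) ≤ 69 * γ := by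
    rw [← density_equiv (Equiv.sumArrowEquivProdArrow _ _ V).symm]
    exact hσ
  obtain ⟨c, a, ha⟩ := exists_prod_of_symmetric ⟨0, hr⟩ (fun v => H.mark v)
    (fun v π => H.mark_comp_equiv v π) p σ hσ'
  have hmean : |𝔼 x, ((a x : ℤ) : ℝ)| ≤ ε / (8 * r) := by
    have h1 := abs_expect_pow_le ha hp
    -- The error is `2 * (2 * r * (69 * γ)) + 2 * (9 * γ)`, at most `294 * r * γ`; the constant
    -- `350` leaves room for this and for the final total below.
    refine le_of_pow_le_pow_left₀ hr.ne' (by positivity) (h1.trans (le_trans ?_ hγε))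
    nlinarith
  obtain ⟨A, hA, hAa⟩ := exists_half_card_density_le a
  refine isClose_of_density_le (ι := Fin r ⊕ Fin r) (by simp [hk]; ring) H hA σ ?_
  set s : V → ℤˣ := fun x => if x ∈ A then -1 else 1 with hs
  have h1 : density (fun v : Fin r ⊕ Fin r → V => ∃ i, a (v i) ≠ s (v i)) ≤
      2 * r * (|𝔼 x, ((a x : ℤ) : ℝ)| / 2 + 1 / Fintype.card V) := by
    refine (density_exists_le _).trans ?_
    refine (sum_le_card_nsmul _ _ _ fun i _ =>
      (density_apply i (fun x => a x ≠ s x)).trans_le hAa).trans ?_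
    simp [two_mul, mul_add]
  have h2 : density (fun v : Fin r ⊕ Fin r → V =>
      p (v ∘ Sum.inl) ≠ c * ∏ i, a ((v ∘ Sum.inl) i)) ≤ 2 * r * (69 * γ) :=
    (density_comp_injective Sum.inl_injective fun x => p x ≠ c * ∏ i, a (x i)).trans_le ha
  have h3 : density (fun v : Fin r ⊕ Fin r → V =>
      p (v ∘ Sum.inr) ≠ c * ∏ i, a ((v ∘ Sum.inr) i)) ≤ 2 * r * (69 * γ) :=
    (density_comp_injective Sum.inr_injective fun x => p x ≠ c * ∏ i, a (x i)).trans_le ha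
  have h4 : density (fun v : Fin r ⊕ Fin r → V => H.mark v ≠ σ * ∏ i, s (v i)) ≤ _ :=
    (density_mono fun v hv => ?_).trans (((density_or_le _ _).trans (add_le_add hσ'
      (density_or_le _ _))).trans (add_le_add_right (add_le_add h1
        ((density_or_le _ _).trans (add_le_add h2 h3))) _))
  · refine h4.trans ?_
    have h5 : (ε / (8 * r)) ^ r ≤ ε / (8 * r) :=
      pow_le_of_le_one (by positivity) (by rw [div_le_one (by positivity)]; linarith) hr.ne'
    have h6 : ε / (8 * r) ≤ ε / 8 := by gcongr; linarith
    have h7 : 2 * r * (|𝔼 x, ((a x : ℤ) : ℝ)| / 2 + 1 / Fintype.card V) ≤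
        ε / 8 + 2 * r * γ := by
      have h8 : r * (ε / (8 * r)) = ε / 8 := by field_simp
      nlinarith
    nlinarith
  · by_contra! hc
    obtain ⟨h5, h6, h7, h8⟩ := hc
    refine hv ?_
    rw [h5, h7, h8, prod_congr rfl fun i _ => (h6 i).symm, Fintype.prod_sum_type]
    simp only [Function.comp]
    rw [mul_mul_mul_comm, Int.units_mul_self, one_mul]

end KGraph

/-! ### Minimum degree as a density of random extensions -/

namespace KGraph

section Degree

/-- Such tuples are injections of `ι` into `e`, a set of the same size. This converts counts of
tuples into counts of sets. -/
theorem card_injective_image_eq_le {ι V : Type*} [Fintype ι] [DecidableEq ι] [Fintype V]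
    [DecidableEq V] (S : Finset (ι → V)) (hS : ∀ v ∈ S, Function.Injective v) (e : Finset V) :
    #{v ∈ S | univ.image v = e} ≤ (Fintype.card ι).factorial := by
  classical
  rcases (S.filter fun v => univ.image v = e).eq_empty_or_nonempty with h | ⟨v₀, h₀⟩
  · simp [h]
  have hcard : #e = Fintype.card ι := by
    rw [mem_filter] at h₀
    rw [← h₀.2, card_image_of_injective _ (hS v₀ h₀.1), card_univ]
  have hmem : ∀ v ∈ S.filter (fun v => univ.image v = e), ∀ i, v i ∈ e := fun v hv i => by
    rw [← (mem_filter.1 hv).2]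
    exact mem_image_of_mem v (mem_univ i)
  rw [← Fintype.card_coe]
  let F : {v // v ∈ S.filter fun v => univ.image v = e} → (ι ↪ e) := fun v =>
    ⟨fun i => ⟨v.1 i, hmem v.1 v.2 i⟩, fun i j hij =>
      hS v.1 (mem_filter.1 v.2).1 (congrArg Subtype.val hij)⟩
  have hF : Function.Injective F := fun v w hvw => by
    ext i
    exact congrArg Subtype.val (DFunLike.congr_fun hvw i)
  refine (Fintype.card_le_of_injective F hF).trans ?_
  rw [Fintype.card_embedding_eq, Fintype.card_coe, hcard, Nat.descFactorial_self]

variable {V : Type*} [DecidableEq V] {k : ℕ}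

theorem minDegree_le_degree (H : KGraph V k) {d : ℕ} {S : Finset V} (hS : #S = d) :
    H.minDegree d ≤ H.degree S :=
  ciInf_le (OrderBot.bddBelow _) (⟨S, hS⟩ : {S : Finset V // S.card = d})

variable [Fintype V]

theorem degree_eq_card_filter_powersetCard (H : KGraph V k) (S : Finset V) :
    H.degree S = #{e ∈ powersetCard (k - #S) Sᶜ | S ∪ e ∈ H.edges} := by
  classical
  refine card_nbij' (fun e => e \ S) (fun e => S ∪ e) ?_ ?_ ?_ ?_
  · intro e he
    simp only [coe_filter, Set.mem_ofPred_eq] at he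
    simp only [coe_filter, Set.mem_ofPred_eq, mem_powersetCard]
    refine ⟨⟨fun x hx => ?_, ?_⟩, ?_⟩
    · simpa using (mem_sdiff.1 hx).2
    · rw [card_sdiff_of_subset he.2, H.card_of_mem e he.1]
    · rw [union_sdiff_of_subset he.2]
      exact he.1
  · intro e he
    simp only [coe_filter, Set.mem_ofPred_eq] at he ⊢
    exact ⟨he.2, subset_union_left⟩
  · intro e he
    simp only [coe_filter, Set.mem_ofPred_eq] at he
    exact union_sdiff_of_subset he.2
  · intro e he
    simp only [coe_filter, Set.mem_ofPred_eq, mem_powersetCard] at he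
    exact union_sdiff_cancel_left (disjoint_left.2 fun x hx hx' =>
      (mem_compl.1 (he.1.1 hx')) hx)

/-- A lower bound on the minimum degree, in terms of random extensions of a tuple. -/
theorem le_density_mark_of_minDegree [Nonempty V] (H : KGraph V k) {ι κ : Type*} [Fintype ι]
    [DecidableEq ι] [Fintype κ] {d : ℕ} (hκ : Fintype.card κ = d) (hι : d + Fintype.card ι = k)
    {γ : ℝ} (hγ : 0 ≤ γ)
    (hdeg : (1 / 2 - γ) * ((Fintype.card V - d).choose (k - d) : ℝ) ≤ (H.minDegree d : ℝ))
    (X : κ → V) : 1 / 2 - γ ≤ density fun Y : ι → V => H.mark (Sum.elim X Y) = 1 := by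
  classical
  set n := Fintype.card V with hn
  by_cases hX : Function.Injective X
  swap
  -- Since tuples with a repetition have sign `1`, a degenerate `X` has full degree and needs no
  -- exception.
  · have h1 : density (fun Y : ι → V => H.mark (Sum.elim X Y) = 1) = 1 := by
      rw [density_congr (t := fun _ => True)]
      · simp [density]
      · intro Y
        refine iff_of_true ((H.mark_eq_one_iff _).2 fun h => (hX ?_).elim) trivial
        exact h.comp Sum.inl_injective
    linarith
  set F := univ.image X with hF
  have hFd : #F = d := by rw [hF, card_image_of_injective _ hX, card_univ, hκ]
  set e := Fintype.card ι with he
  have hke : k - d = e := by omega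
  set N : Finset (Finset V) := {s ∈ powersetCard (k - d) Fᶜ | F ∪ s ∉ H.edges} with hN
  have hNcard : (#N : ℝ) ≤ (1 / 2 + γ) * ((n - d).choose e : ℝ) := by
    have h1 := card_filter_add_card_filter_not (s := powersetCard (k - d) Fᶜ)
      (fun s => F ∪ s ∈ H.edges)
    have h2 := H.degree_eq_card_filter_powersetCard F
    rw [hFd] at h2
    rw [← h2, card_powersetCard, card_compl, hFd, ← hN, ← hn] at h1
    have h3 : (H.minDegree d : ℝ) ≤ H.degree F := by exact_mod_cast H.minDegree_le_degree hFd
    have h4 : (H.degree F : ℝ) + #N = ((n - d).choose (k - d) : ℝ) := by exact_mod_cast h1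
    rw [hke] at h4 hdeg
    linarith
  set S : Finset (ι → V) := {Y | ¬ H.mark (Sum.elim X Y) = 1} with hS
  have hSmem : ∀ Y ∈ S, Function.Injective (Sum.elim X Y) ∧
      univ.image (Sum.elim X Y) ∉ H.edges := fun Y hY => by
    have := (mem_filter.1 hY).2
    rw [mark_eq_one_iff] at this
    tauto
  have hScard : #S ≤ e.factorial * #N := by
    refine (card_le_mul_card_image S e.factorial (f := fun Y => univ.image Y) fun s _ =>
      card_injective_image_eq_le S (fun Y hY => (hSmem Y hY).1.comp Sum.inr_injective) s).trans ?_
    refine Nat.mul_le_mul_left _ (card_le_card fun s hs => ?_)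
    obtain ⟨Y, hY, rfl⟩ := mem_image.1 hs
    obtain ⟨hinj, hedge⟩ := hSmem Y hY
    rw [hN, mem_filter, mem_powersetCard]
    refine ⟨⟨fun x hx => ?_, ?_⟩, ?_⟩
    · obtain ⟨i, -, rfl⟩ := mem_image.1 hx
      rw [mem_compl, hF, mem_image]
      rintro ⟨j, -, hj⟩
      exact Sum.inl_ne_inr (hinj (a₁ := Sum.inl j) (a₂ := Sum.inr i) (by simpa using hj))
    · have hY' : Function.Injective Y := hinj.comp Sum.inr_injective
      rw [card_image_of_injective _ hY', card_univ, hke]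
    · convert hedge
      ext x
      simp [hF]
  -- Bounding the non-edges rather than the edges avoids lower-order losses: `e! * (n - d).choose e`
  -- is at most `n ^ e`, which is the favourable direction.
  have hSn : (#S : ℝ) ≤ (1 / 2 + γ) * (n : ℝ) ^ e := by
    have h1 : (#S : ℝ) ≤ e.factorial * #N := by exact_mod_cast hScard
    have h2 : (e.factorial : ℝ) * ((n - d).choose e : ℝ) ≤ (n : ℝ) ^ e := by
      have : e.factorial * (n - d).choose e ≤ n ^ e := by
        rw [← Nat.descFactorial_eq_factorial_mul_choose]
        exact (Nat.descFactorial_le_pow _ _).trans (Nat.pow_le_pow_left (Nat.sub_le _ _) _)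
      exact_mod_cast this
    have h3 : (0 : ℝ) ≤ e.factorial := by positivity
    nlinarith
  have h5 := density_not_add fun Y : ι → V => H.mark (Sum.elim X Y) = 1
  have h6 : density (fun Y : ι → V => ¬ H.mark (Sum.elim X Y) = 1) ≤ 1 / 2 + γ := by
    have hn0 : (0 : ℝ) < n := by exact_mod_cast Fintype.card_pos
    rw [density_eq_card_div, Fintype.card_fun, Nat.cast_pow, div_le_iff₀ (by positivity)]
    exact hSn
  linarith

/-- Choose the first `d - r` entries of `Y` arbitrarily: together with `X` they form a `d`-tuple, to
which the degree bound applies. Then average over these entries. -/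
theorem le_density_mark_half [Nonempty V] (H : KGraph V k) {r d : ℕ} (hk : k = 2 * r)
    (hrd : r ≤ d) (hdk : d ≤ k) {γ : ℝ} (hγ : 0 ≤ γ)
    (hdeg : (1 / 2 - γ) * ((Fintype.card V - d).choose (k - d) : ℝ) ≤ (H.minDegree d : ℝ))
    (X : Fin r → V) : 1 / 2 - γ ≤ density fun Y : Fin r → V => H.mark (Sum.elim X Y) = 1 := by
  let e : Fin r ≃ Fin (d - r) ⊕ Fin (k - d) :=
    (finCongr (by omega : r = (d - r) + (k - d))).trans finSumFinEquiv.symm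
  rw [← density_equiv (Equiv.arrowCongr e.symm (Equiv.refl V)),
    ← density_equiv (Equiv.sumArrowEquivProdArrow _ _ V).symm]
  refine le_density_prod fun Y₁ => ?_
  refine (H.le_density_mark_of_minDegree (κ := Fin r ⊕ Fin (d - r)) (ι := Fin (k - d))
    (by simp; omega) (by simp; omega) hγ hdeg (Sum.elim X Y₁)).trans (density_mono fun Y₂ h => ?_)
  rw [← h, ← H.mark_comp_equiv (Sum.elim (Sum.elim X Y₁) Y₂)
    (((Equiv.refl (Fin r)).sumCongr e).trans (Equiv.sumAssoc _ _ _).symm)]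
  congr 1
  funext i
  rcases i with i | i
  · simp
  · simp only [Sum.elim_inr, Function.comp, Equiv.arrowCongr_apply, Equiv.symm_symm, Equiv.coe_refl,
      id, Equiv.trans_apply, Equiv.sumCongr_apply, Sum.map_inr]
    rcases e i with j | j <;> simp [Equiv.sumArrowEquivProdArrow]

end Degree

end KGraph

/-! ### Walks of length four as paths -/

namespace KGraph

section Walk

variable {V : Type*} [DecidableEq V] {k : ℕ}

/-- As `k - k / 2 = r`, consecutive edges of the path advance by one block of `r` vertices, so each
edge is the union of two neighbouring blocks. -/
theorem isPath_of_blocks (H : KGraph V k) {r : ℕ} (hk : k = 2 * r) {L₀ L₁ L₂ L₃ L₄ : List V}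
    (h₀ : L₀.length = r) (h₁ : L₁.length = r) (h₂ : L₂.length = r) (h₃ : L₃.length = r)
    (h₄ : L₄.length = r) (hnd : (L₀ ++ (L₁ ++ (L₂ ++ (L₃ ++ L₄)))).Nodup)
    (e₀ : L₀.toFinset ∪ L₁.toFinset ∈ H.edges) (e₁ : L₁.toFinset ∪ L₂.toFinset ∈ H.edges)
    (e₂ : L₂.toFinset ∪ L₃.toFinset ∈ H.edges) (e₃ : L₃.toFinset ∪ L₄.toFinset ∈ H.edges) :
    H.IsPath (k / 2) 4 (L₀ ++ (L₁ ++ (L₂ ++ (L₃ ++ L₄)))) := by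
  have hkr : k / 2 = r := by omega
  have hkr' : k - r = r := by omega
  have key : ∀ L L' M : List V, L.length = r → L'.length = r →
      ((L ++ (L' ++ M)).take k).toFinset = L.toFinset ∪ L'.toFinset := by
    intro L L' M h h'
    rw [← List.append_assoc, List.take_left' (by simp [h, h']; omega), List.toFinset_append]
  have hdrop : ∀ (L M : List V) (i : ℕ), L.length = r →
      (L ++ M).drop ((i + 1) * r) = M.drop (i * r) := by
    intro L M i h
    rw [show (i + 1) * r = L.length + i * r by rw [h]; ring, List.drop_append]
    simp
  refine ⟨by norm_num, hnd, ?_, ?_⟩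
  · simp only [List.length_append, h₀, h₁, h₂, h₃, h₄, hkr, hkr']
    omega
  · intro i hi
    rw [hkr, hkr']
    interval_cases i
    · rw [zero_mul, List.drop_zero, key _ _ _ h₀ h₁]
      exact e₀
    · rw [hdrop _ _ 0 h₀, zero_mul, List.drop_zero, key _ _ _ h₁ h₂]
      exact e₁
    · rw [hdrop _ _ 1 h₀, hdrop _ _ 0 h₁, zero_mul, List.drop_zero, key _ _ _ h₂ h₃]
      exact e₂
    · rw [hdrop _ _ 2 h₀, hdrop _ _ 1 h₁, hdrop _ _ 0 h₂, zero_mul, List.drop_zero]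
      have := key L₃ L₄ [] h₃ h₄
      rw [List.append_nil] at this
      rw [this]
      exact e₃

theorem toFinset_ofFn {r : ℕ} (f : Fin r → V) : (List.ofFn f).toFinset = univ.image f := by
  ext x
  simp [List.mem_ofFn]

theorem union_image_mem_of_mark_eq_one (H : KGraph V k) {ι κ : Type*} [Fintype ι] [Fintype κ]
    {x : ι → V} {y : κ → V} (h : H.mark (Sum.elim x y) = 1) (hx : Function.Injective x)
    (hy : Function.Injective y) (hxy : ∀ i j, x i ≠ y j) :
    univ.image x ∪ univ.image y ∈ H.edges := by
  convert (H.mark_eq_one_iff _).1 h (hx.sumElim hy hxy)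
  ext a
  simp

/-- A nondegenerate walk of length four yields a connecting set. -/
theorem isConnecting_of_walk (H : KGraph V k) {r : ℕ} (hk : k = 2 * r) {s t : Fin r → V}
    (hs : Function.Injective s) (ht : Function.Injective t) (hst : ∀ i j, s i ≠ t j)
    {w : Fin r ⊕ (Fin r ⊕ Fin r) → V} (hw : Function.Injective w)
    (hws : ∀ j, w j ∉ univ.image s ∪ univ.image t)
    (h₀ : H.mark (Sum.elim s (w ∘ Sum.inr ∘ Sum.inl)) = 1)
    (h₁ : H.mark (Sum.elim (w ∘ Sum.inl) (w ∘ Sum.inr ∘ Sum.inl)) = 1)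
    (h₂ : H.mark (Sum.elim (w ∘ Sum.inl) (w ∘ Sum.inr ∘ Sum.inr)) = 1)
    (h₃ : H.mark (Sum.elim t (w ∘ Sum.inr ∘ Sum.inr)) = 1) :
    H.IsConnecting (univ.image s) (univ.image t) (univ.image w) := by
  have hkr : k / 2 = r := by omega
  set y := w ∘ Sum.inl with hy
  set x := w ∘ Sum.inr ∘ Sum.inl with hx
  set z := w ∘ Sum.inr ∘ Sum.inr with hz
  have hyi : Function.Injective y := hw.comp Sum.inl_injective
  have hxi : Function.Injective x := hw.comp (Sum.inr_injective.comp Sum.inl_injective)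
  have hzi : Function.Injective z := hw.comp (Sum.inr_injective.comp Sum.inr_injective)
  have hsw : ∀ i j, s i ≠ w j := fun i j h => hws j (by simp [← h])
  have htw : ∀ i j, t i ≠ w j := fun i j h => hws j (by simp [← h])
  have hxy : ∀ i j, x i ≠ y j := fun i j => hw.ne (by simp)
  have hyz : ∀ i j, y i ≠ z j := fun i j => hw.ne (by simp)
  have hxz : ∀ i j, x i ≠ z j := fun i j => hw.ne (by simp)
  have hdisj : ∀ {a b : Fin r → V}, (∀ i j, a i ≠ b j) →
      ∀ c ∈ List.ofFn a, ∀ d ∈ List.ofFn b, c ≠ d := by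
    intro a b h c hc d hd
    obtain ⟨i, rfl⟩ := (List.mem_ofFn' _ _).1 hc
    obtain ⟨j, rfl⟩ := (List.mem_ofFn' _ _).1 hd
    exact h i j
  have hwimage : univ.image w = univ.image x ∪ (univ.image y ∪ univ.image z) := by
    ext a
    simp only [mem_image, mem_univ, true_and, mem_union, Sum.exists, hx, hy, hz, Function.comp]
    tauto
  refine ⟨?_, ?_, 4, List.ofFn s ++ (List.ofFn x ++ (List.ofFn y ++ (List.ofFn z ++ List.ofFn t))),
    H.isPath_of_blocks hk (by simp) (by simp) (by simp) (by simp) (by simp) ?_ ?_ ?_ ?_ ?_,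
    ?_, ?_, ?_⟩
  · refine disjoint_left.2 fun a ha hb => ?_
    obtain ⟨j, -, rfl⟩ := mem_image.1 ha
    exact hws j (mem_union_left _ hb)
  · refine disjoint_left.2 fun a ha hb => ?_
    obtain ⟨j, -, rfl⟩ := mem_image.1 ha
    exact hws j (mem_union_right _ hb)
  · have d1 := hdisj (a := s) (b := x) fun i j => hsw i _
    have d2 := hdisj (a := s) (b := y) fun i j => hsw i _
    have d3 := hdisj (a := s) (b := z) fun i j => hsw i _
    have d4 := hdisj hst
    have d5 := hdisj hxy
    have d6 := hdisj hxz
    have d7 := hdisj (a := x) (b := t) fun i j => (htw j _).symm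
    have d8 := hdisj hyz
    have d9 := hdisj (a := y) (b := t) fun i j => (htw j _).symm
    have d10 := hdisj (a := z) (b := t) fun i j => (htw j _).symm
    simp only [List.nodup_append, List.nodup_ofFn, List.mem_append]
    refine ⟨hs, ⟨hxi, ⟨hyi, ⟨hzi, ht, d10⟩, ?_⟩, ?_⟩, ?_⟩
    · rintro a ha b (hb | hb)
      exacts [d8 a ha b hb, d9 a ha b hb]
    · rintro a ha b (hb | hb | hb)
      exacts [d5 a ha b hb, d6 a ha b hb, d7 a ha b hb]
    · rintro a ha b (hb | hb | hb | hb)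
      exacts [d1 a ha b hb, d2 a ha b hb, d3 a ha b hb, d4 a ha b hb]
  · rw [toFinset_ofFn, toFinset_ofFn]
    exact H.union_image_mem_of_mark_eq_one h₀ hs hxi fun i j => hsw i _
  · rw [toFinset_ofFn, toFinset_ofFn, union_comm]
    exact H.union_image_mem_of_mark_eq_one h₁ hyi hxi fun i j => (hxy j i).symm
  · rw [toFinset_ofFn, toFinset_ofFn]
    exact H.union_image_mem_of_mark_eq_one h₂ hyi hzi hyz
  · rw [toFinset_ofFn, toFinset_ofFn, union_comm]
    exact H.union_image_mem_of_mark_eq_one h₃ ht hzi fun i j => htw i _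
  · rw [hwimage]
    simp only [List.toFinset_append, toFinset_ofFn, union_assoc]
  · rw [hkr, List.take_left' (by simp), toFinset_ofFn]
  · rw [← List.append_assoc, ← List.append_assoc, ← List.append_assoc, hkr,
      List.drop_left' (by simp), toFinset_ofFn]

end Walk

end KGraph

/-! ### Counting connecting sets -/

namespace KGraph

section Connecting

variable {V : Type*} [DecidableEq V] [Fintype V] {k : ℕ}

/-- If there are few connecting sets, then there are few walks of length four. -/
theorem density_walk_le [Nonempty V] (H : KGraph V k) {r : ℕ} (hk : k = 2 * r) {s t : Fin r → V}
    (hs : Function.Injective s) (ht : Function.Injective t) (hst : ∀ i j, s i ≠ t j) {c : ℝ}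
    (hc : (#(H.connectingSets (3 * r) (univ.image s) (univ.image t)) : ℝ) ≤
      c * (Fintype.card V : ℝ) ^ (3 * r)) :
    density (fun v : (Fin r → V) × (Fin r → V) × (Fin r → V) =>
      (H.mark (Sum.elim s v.2.1) = 1 ∧ H.mark (Sum.elim v.1 v.2.1) = 1) ∧
      (H.mark (Sum.elim t v.2.2) = 1 ∧ H.mark (Sum.elim v.1 v.2.2) = 1)) ≤
      (3 * r).factorial * c + 15 * (r : ℝ) ^ 2 / Fintype.card V := by
  classical
  set n := Fintype.card V with hn
  have hn0 : (0 : ℝ) < n := by exact_mod_cast Fintype.card_pos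
  let E : (Fin r ⊕ (Fin r ⊕ Fin r) → V) ≃ (Fin r → V) × (Fin r → V) × (Fin r → V) :=
    (Equiv.sumArrowEquivProdArrow _ _ V).trans
      ((Equiv.refl _).prodCongr (Equiv.sumArrowEquivProdArrow _ _ V))
  rw [← density_equiv E]
  have hcard : Fintype.card (Fin r ⊕ (Fin r ⊕ Fin r)) = 3 * r := by simp; ring
  set F := univ.image s ∪ univ.image t with hF
  set good : (Fin r ⊕ (Fin r ⊕ Fin r) → V) → Prop := fun w =>
    (Function.Injective w ∧ ∀ j, w j ∉ F) ∧
    ((H.mark (Sum.elim s (w ∘ Sum.inr ∘ Sum.inl)) = 1 ∧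
      H.mark (Sum.elim (w ∘ Sum.inl) (w ∘ Sum.inr ∘ Sum.inl)) = 1) ∧
    (H.mark (Sum.elim t (w ∘ Sum.inr ∘ Sum.inr)) = 1 ∧
      H.mark (Sum.elim (w ∘ Sum.inl) (w ∘ Sum.inr ∘ Sum.inr)) = 1)) with hgood
  have hbad := density_not_injective_or_mem_le (J := Fin r ⊕ (Fin r ⊕ Fin r)) F
  have hFcard : (#F : ℝ) ≤ 2 * r := by
    have h1 : #F ≤ r + r := (card_union_le _ _).trans
      (add_le_add (card_image_le.trans (by simp)) (card_image_le.trans (by simp)))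
    have h2 : (#F : ℝ) ≤ r + r := by exact_mod_cast h1
    linarith
  -- A random `3r`-tuple must avoid repetitions and the at most `2r` vertices of `F`, and `3r * (3r
  -- + 2r) = 15r²`.
  have hbad' : ((3 * r : ℕ) * ((3 * r : ℕ) + #F) : ℝ) / n ≤ 15 * (r : ℝ) ^ 2 / n := by
    refine div_le_div_of_nonneg_right ?_ hn0.le
    push_cast
    nlinarith [(Nat.cast_nonneg r : (0 : ℝ) ≤ r)]
  have hgoodc : density good ≤ (3 * r).factorial * c := by
    rw [density_eq_card_div, Fintype.card_fun, hcard, Nat.cast_pow,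
      div_le_iff₀ (by positivity), mul_assoc]
    have h1 : #{w | good w} ≤ (3 * r).factorial *
        #(H.connectingSets (3 * r) (univ.image s) (univ.image t)) := by
      rw [← hcard]
      refine (card_le_mul_card_image _ _ (f := fun w => univ.image w) fun e _ =>
        card_injective_image_eq_le _ (fun w hw => (mem_filter.1 hw).2.1.1) e).trans ?_
      refine Nat.mul_le_mul_left _ (card_le_card fun e he => ?_)
      obtain ⟨w, hw, rfl⟩ := mem_image.1 he
      obtain ⟨⟨hwi, hwF⟩, ⟨h1, h2⟩, h3, h4⟩ := (mem_filter.1 hw).2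
      rw [connectingSets, mem_filter, mem_powersetCard]
      refine ⟨⟨subset_univ _, by rw [card_image_of_injective _ hwi, card_univ]⟩, ?_⟩
      exact H.isConnecting_of_walk hk hs ht hst hwi hwF h1 h2 h4 h3
    have h2 : (#{w | good w} : ℝ) ≤ (3 * r).factorial *
        #(H.connectingSets (3 * r) (univ.image s) (univ.image t)) := by exact_mod_cast h1
    exact h2.trans (mul_le_mul_of_nonneg_left hc (by positivity))
  rw [hcard] at hbad
  refine (density_le_add (t := good) (u := fun w => ¬ (Function.Injective w ∧ ∀ j, w j ∉ F))
    fun w hw => ?_).trans (add_le_add hgoodc (hbad.trans hbad'))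
  by_cases h : Function.Injective w ∧ ∀ j, w j ∉ F
  · exact Or.inl ⟨h, hw⟩
  · exact Or.inr h

/-- The contradiction argument with explicit smallness conditions on `γ` and `1 / n`. -/
theorem card_connectingSets_ge (H : KGraph V k) {r d : ℕ} (hr : 0 < r) (hk : k = 2 * r)
    (hrd : r ≤ d) (hdk : d ≤ k) {γ ε : ℝ} (hγ : 0 < γ) (hγ4 : γ ≤ 1 / 4) (hε : 0 < ε)
    (hε1 : ε ≤ 1) (hrγ : r * γ ≤ 1 / 2) (hfac : (3 * r).factorial * γ ≤ 1 / 2)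
    (hγε : 350 * r * γ ≤ (ε / (8 * r)) ^ r) (hn : 1 / (Fintype.card V : ℝ) ≤ γ ^ 5 / 100)
    (hdeg : (1 / 2 - γ) * ((Fintype.card V - d).choose (k - d) : ℝ) ≤ (H.minDegree d : ℝ))
    (hodd : ¬ H.IsCloseToOdd ε) (heven : ¬ H.IsCloseToEven ε) {A B : Finset V} (hA : #A = r)
    (hB : #B = r) (hAB : Disjoint A B) :
    γ ^ 4 * (Fintype.card V : ℝ) ^ (3 * r) ≤ (#(H.connectingSets (3 * r) A B) : ℝ) := by
  by_contra! hlt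
  obtain ⟨s, hs, rfl⟩ := exists_tuple_of_card (ι := Fin r) (by simpa using hA)
  obtain ⟨t, ht, rfl⟩ := exists_tuple_of_card (ι := Fin r) (by simpa using hB)
  have hst : ∀ i j, s i ≠ t j := fun i j h => disjoint_left.1 hAB
    (mem_image_of_mem s (mem_univ i)) (h ▸ mem_image_of_mem t (mem_univ j))
  have : Nonempty V := ⟨s ⟨0, hr⟩⟩
  -- The exponent `4` beats the `γ ^ 3` needed for few walks by one factor `γ`, which absorbs
  -- `(3r)!`. The bound `γ ^ 5 / 100` on `1 / n` makes the degenerate walks negligible, as `r * γ ≤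
  -- 1 / 2`.
  have hwalk : (3 * r).factorial * γ ^ 4 + 15 * (r : ℝ) ^ 2 / Fintype.card V ≤ γ ^ 3 := by
    have h1 : (0 : ℝ) < γ ^ 3 := by positivity
    have h2 : 15 * (r : ℝ) ^ 2 / Fintype.card V ≤ 15 * (r : ℝ) ^ 2 * (γ ^ 5 / 100) := by
      rw [div_eq_mul_one_div]
      exact mul_le_mul_of_nonneg_left hn (by positivity)
    have h3 : 15 * (r : ℝ) ^ 2 * (γ ^ 5 / 100) = 15 / 100 * (r * γ) ^ 2 * γ ^ 3 := by ring
    have h4 : (r * γ) ^ 2 ≤ 1 := pow_le_one₀ (by positivity) (by linarith)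
    have h5 : ((3 * r).factorial : ℝ) * γ ^ 4 = (3 * r).factorial * γ * γ ^ 3 := by ring
    nlinarith
  obtain ⟨⟨σ, hσ⟩, hp⟩ := exists_sign_of_few_walks
    (fun X Y : Fin r → V => H.mark (Sum.elim X Y))
    (fun X Y => by
      rw [← H.mark_comp_equiv _ (Equiv.sumComm _ _)]
      congr 1
      funext i
      rcases i with i | i <;> rfl)
    hγ hγ4 (H.le_density_mark_half hk hrd hdk hγ.le hdeg) s t
    ((H.density_walk_le hk hs ht hst hlt.le).trans hwalk)
  have hn' : 1 / (Fintype.card V : ℝ) ≤ γ := by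
    have : γ ^ 5 ≤ γ := pow_le_of_le_one hγ.le (by linarith) (by norm_num)
    linarith
  exact (H.isClose_of_sign hr hk (fun X => H.mark (Sum.elim s X)) hγ hε hε1 hn' hσ hp hγε).elim
    hodd heven

end Connecting

end KGraph

/-! ### The hierarchy of constants -/

/-- Any positive sequence gives rise to an increasing function below it. -/
theorem exists_strictMonoOn_le (δ : ℕ → ℝ) (hδ : ∀ j, 0 < δ j) :
    ∃ g : ℝ → ℝ, Set.MapsTo g (Set.Ioi 0) (Set.Ioi 0) ∧ StrictMonoOn g (Set.Ioi 0) ∧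
      ∀ x, 0 < x → g x ≤ δ ⌈1 / x⌉₊ ∧ g x ≤ x := by
  set D : ℕ → ℝ := fun j => ∏ i ∈ range (j + 1), min 1 (δ i) with hD
  have hpos : ∀ i, 0 < min 1 (δ i) := fun i => lt_min one_pos (hδ i)
  have hDpos : ∀ j, 0 < D j := fun j => prod_pos fun i _ => hpos i
  have hD1 : ∀ j, D j ≤ 1 := fun j => prod_le_one (fun i _ => (hpos i).le) fun i _ => min_le_left _ _
  have hanti : Antitone D := antitone_nat_of_succ_le fun j => by
    simp only [hD]
    rw [prod_range_succ _ (j + 1)]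
    exact mul_le_of_le_one_right (hDpos j).le (min_le_left _ _)
  have hDδ : ∀ j, D j ≤ δ j := fun j => by
    simp only [hD]
    rw [prod_range_succ]
    exact (mul_le_of_le_one_left (hpos j).le (prod_le_one (fun i _ => (hpos i).le)
      fun i _ => min_le_left _ _)).trans (min_le_right _ _)
  -- The partial products `D` decrease and lie below `δ`, so `D ⌈1 / x⌉₊` is monotone in `x`; the
  -- factor `x / (1 + x)` makes it strictly so and keeps it below `x`.
  refine ⟨fun x => D ⌈1 / x⌉₊ * (x / (1 + x)), fun x hx => ?_, fun x hx y hy hxy => ?_,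
    fun x hx => ⟨?_, ?_⟩⟩
  · rw [Set.mem_Ioi] at hx ⊢
    have := hDpos ⌈1 / x⌉₊
    positivity
  · rw [Set.mem_Ioi] at hx hy
    have h1 : D ⌈1 / x⌉₊ ≤ D ⌈1 / y⌉₊ :=
      hanti (Nat.ceil_mono (one_div_le_one_div_of_le hx hxy.le))
    have h2 : x / (1 + x) < y / (1 + y) := by
      rw [div_lt_div_iff₀ (by linarith) (by linarith)]
      nlinarith
    exact mul_lt_mul' h1 h2 (by positivity) (hDpos _)
  · refine (mul_le_of_le_one_right (hDpos _).le ?_).trans (hDδ _)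
    rw [div_le_one (by linarith)]
    linarith
  · refine (mul_le_of_le_one_left (by positivity) (hD1 _)).trans ?_
    exact div_le_self hx.le (by linarith)

/-- The hierarchy `1/n ≪ γ ≪ ε ≪ 1/k` means that there are increasing functions `f`, `g`, `h` from
the positive reals to the positive reals such that the assertion holds whenever `ε ≤ f (1/k)`,
`γ ≤ g ε` and `1/n ≤ h γ`. -/
theorem lemma2p5 :
    ∃ f g h : ℝ → ℝ,
      (Set.MapsTo f (Set.Ioi 0) (Set.Ioi 0) ∧ StrictMonoOn f (Set.Ioi 0)) ∧
      (Set.MapsTo g (Set.Ioi 0) (Set.Ioi 0) ∧ StrictMonoOn g (Set.Ioi 0)) ∧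
      (Set.MapsTo h (Set.Ioi 0) (Set.Ioi 0) ∧ StrictMonoOn h (Set.Ioi 0)) ∧
      ∀ k d n : ℕ, Even k → 4 ≤ k → k / 2 ≤ d → d ≤ k - 1 → 0 < n →
      ∀ ε γ : ℝ, 0 < ε → ε ≤ f (1 / k) → 0 < γ → γ ≤ g ε → 1 / (n : ℝ) ≤ h γ →
      ∀ (V : Type*) [Fintype V] [DecidableEq V], Fintype.card V = n →
      ∀ H : KGraph V k,
        (1 / 2 - γ) * ((n - d).choose (k - d) : ℝ) ≤ (H.minDegree d : ℝ) →
        ¬ H.IsCloseToOdd ε → ¬ H.IsCloseToEven ε →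
        ∀ A B : Finset V, A.card = k / 2 → B.card = k / 2 → Disjoint A B →
          γ ^ 4 * (n : ℝ) ^ (3 * k / 2) ≤ ((H.connectingSets (3 * k / 2) A B).card : ℝ) := by
  -- Here `j` stands for `⌈1 / ε⌉₊`, which bounds `r` because `ε ≤ 1 / k`. The threshold for `γ` can
  -- thus depend on `ε` alone and serve all admissible `r` at once. Writing `j + 1` keeps it
  -- positive at `j = 0`.
  set δ : ℕ → ℝ := fun j =>
    (1 / (8 * (j + 1) * (j + 1)) : ℝ) ^ (j + 1) / (350 * (j + 1) * (3 * j).factorial) with hδ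
  obtain ⟨g, hg, hgmono, hgle⟩ := exists_strictMonoOn_le δ fun j => by positivity
  refine ⟨id, g, fun x => x ^ 5 / 100, ⟨fun x hx => hx, fun x _ y _ h => h⟩, ⟨hg, hgmono⟩,
    ⟨fun x hx => ?_, fun x hx y _ hxy => ?_⟩, ?_⟩
  · rw [Set.mem_Ioi] at hx ⊢
    positivity
  · exact div_lt_div_of_pos_right (pow_lt_pow_left₀ hxy (le_of_lt hx) (by norm_num)) (by norm_num)
  intro k d n hkeven hk4 hkd hdk _ ε γ hε hεk hγ hγε hn V _ _ hV H hdeg hodd heven A B hA hB hAB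
  obtain ⟨r, hr⟩ := hkeven
  have hk : k = 2 * r := by omega
  have hkr : k / 2 = r := by omega
  have h3 : 3 * k / 2 = 3 * r := by omega
  rw [hkr] at hkd hA hB
  rw [h3]
  subst hV
  have hr2 : (2 : ℝ) ≤ r := by exact_mod_cast (by omega : 2 ≤ r)
  have hkR : (k : ℝ) = 2 * r := by rw [hk]; push_cast; ring
  obtain ⟨hgδ, hgε⟩ := hgle ε hε
  have hεr : ε * (2 * r) ≤ 1 := by
    rw [id, hkR, le_div_iff₀ (by positivity)] at hεk
    exact hεk
  have hε4 : ε ≤ 1 / 4 := by nlinarith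
  have hγε' : γ ≤ ε := hγε.trans hgε
  set j := ⌈1 / ε⌉₊ with hj
  have hjε : 1 / ε ≤ j := Nat.le_ceil _
  have hrj : (r : ℝ) ≤ j := by
    refine le_trans ?_ hjε
    rw [le_div_iff₀ hε]
    nlinarith
  have hrj' : r ≤ j := by exact_mod_cast hrj
  have hεj : 1 / (j + 1 : ℝ) ≤ ε := by
    rw [div_le_iff₀ (by positivity)]
    rw [div_le_iff₀ hε] at hjε
    nlinarith
  have hγδ : 350 * (j + 1) * (3 * j).factorial * γ ≤
      (1 / (8 * (j + 1) * (j + 1)) : ℝ) ^ (j + 1) := by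
    have h1 := hγε.trans hgδ
    rw [hδ] at h1
    simp only at h1
    rw [le_div_iff₀ (by positivity)] at h1
    linarith
  have hbase : (1 / (8 * (j + 1) * (j + 1)) : ℝ) ≤ 1 := by
    rw [div_le_one (by positivity)]
    nlinarith
  -- Both replacements lower the power: the base by `1 / (j + 1) ≤ ε` and `r ≤ j + 1`, and the
  -- exponent because the base is at most `1`.
  have hpow : (1 / (8 * (j + 1) * (j + 1)) : ℝ) ^ (j + 1) ≤ (ε / (8 * r)) ^ r := by
    refine (pow_le_pow_of_le_one (by positivity) hbase (by omega : r ≤ j + 1)).trans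
      (pow_le_pow_left₀ (by positivity) ?_ r)
    calc (1 / (8 * (j + 1) * (j + 1)) : ℝ) = 1 / (j + 1) / (8 * (j + 1)) := by field_simp
      _ ≤ ε / (8 * r) := by gcongr; linarith
  have hfac : ((3 * r).factorial : ℝ) ≤ (3 * j).factorial := by
    exact_mod_cast Nat.factorial_le (by omega)
  have hfac1 : (1 : ℝ) ≤ (3 * j).factorial := by
    exact_mod_cast Nat.one_le_iff_ne_zero.2 (Nat.factorial_ne_zero _)
  refine H.card_connectingSets_ge (by omega) hk hkd (by omega) hγ (by linarith) hε (by linarith)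
    (by nlinarith) ?_ ?_ hn hdeg hodd heven hA hB hAB
  · have h1 : 350 * (j + 1) * (3 * j).factorial * γ ≤ 1 :=
      hγδ.trans (pow_le_one₀ (by positivity) hbase)
    have h2 : ((3 * r).factorial : ℝ) * γ ≤ (3 * j).factorial * γ := by gcongr
    have h4 : (2 : ℝ) * ((3 * j).factorial * γ) ≤ 350 * (j + 1) * ((3 * j).factorial * γ) := by
      refine mul_le_mul_of_nonneg_right ?_ (by positivity)
      have := (Nat.cast_nonneg j : (0 : ℝ) ≤ j)
      linarith
    linarith
  · refine le_trans ?_ (hγδ.trans hpow)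
    refine mul_le_mul_of_nonneg_right ?_ hγ.le
    nlinarith
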